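/- Let $\kappa$ be an infinite regular cardinal. A $\kappa$-Boolean algebra is a Boolean algebra in which every subset of cardinality $<\kappa$ has a join; let $\kappa\mathsf{Bool}$ be the category of $\kappa$-Boolean algebras and Boolean homomorphisms preserving joins of subsets of cardinality $<\kappa$. Let $$\begin{array}{ccc} A & \xrightarrow{\ f\ } & B \\ {\scriptstyle g}\downarrow & & \downarrow{\scriptstyle g'} \\ C & \xrightarrow{\ f'\ } & B\otimes_A C \end{array}$$ be a pushout square in $\kappa\mathsf{Bool}$. Then for any $b \in B$ and $c \in C$ such that $g'(b) \le f'(c)$ in $B\otimes_A C$, there is $a \in A$ such that $b \le f(a)$ and $g(a) \le c$. -/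

import Mathlib

open CategoryTheory

universe u

/-- A Boolean algebra is `κ`-complete if every subset of cardinality `< κ` has a join. -/
class IsKappaComplete (κ : Cardinal.{u}) (A : Type u) [BooleanAlgebra A] : Prop where
  exists_isLUB : ∀ s : Set A, Cardinal.mk s < κ → ∃ a : A, IsLUB s a

/-- A homomorphism of `κ`-Boolean algebras: a Boolean homomorphism (bounded lattice homomorphisms
between Boolean algebras preserve complements) preserving joins of subsets of cardinality `< κ`. -/
structure KappaBoolHom (κ : Cardinal.{u}) (A B : Type u) [BooleanAlgebra A] [BooleanAlgebra B]
    extends BoundedLatticeHom A B where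
  map_isLUB' : ∀ s : Set A, Cardinal.mk s < κ → ∀ a : A, IsLUB s a → IsLUB (toFun '' s) (toFun a)

namespace KappaBoolHom

variable {κ : Cardinal.{u}} {A B C : Type u}
  [BooleanAlgebra A] [BooleanAlgebra B] [BooleanAlgebra C]

instance : FunLike (KappaBoolHom κ A B) A B where
  coe f := f.toFun
  coe_injective f g h := by
    obtain ⟨f, hf⟩ := f
    obtain ⟨g, hg⟩ := g
    have hfg : f = g := DFunLike.coe_injective h
    subst hfg
    rfl

instance : BoundedLatticeHomClass (KappaBoolHom κ A B) A B where
  map_sup f := f.map_sup'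
  map_inf f := f.map_inf'
  map_top f := f.map_top'
  map_bot f := f.map_bot'

theorem map_isLUB (f : KappaBoolHom κ A B) {s : Set A} (hs : Cardinal.mk s < κ) {a : A}
    (ha : IsLUB s a) : IsLUB (f '' s) (f a) :=
  f.map_isLUB' s hs a ha

/-- The identity homomorphism. -/
def id (κ : Cardinal.{u}) (A : Type u) [BooleanAlgebra A] : KappaBoolHom κ A A where
  toBoundedLatticeHom := BoundedLatticeHom.id A
  map_isLUB' s _ a ha := by
    change IsLUB ((fun x : A => x) '' s) a
    simpa using ha

/-- Composition of homomorphisms. -/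
def comp (g : KappaBoolHom κ B C) (f : KappaBoolHom κ A B) : KappaBoolHom κ A C where
  toBoundedLatticeHom := g.toBoundedLatticeHom.comp f.toBoundedLatticeHom
  map_isLUB' s hs a ha := by
    change IsLUB ((fun x : A => g (f x)) '' s) (g (f a))
    have h := g.map_isLUB (lt_of_le_of_lt Cardinal.mk_image_le hs) (f.map_isLUB hs ha)
    rwa [Set.image_image] at h

end KappaBoolHom

/-- The objects of the category of `κ`-Boolean algebras. -/
structure KappaBool (κ : Cardinal.{u}) where
  /-- The underlying type. -/
  carrier : Type u
  [str : BooleanAlgebra carrier]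
  [complete : IsKappaComplete κ carrier]

attribute [instance] KappaBool.str KappaBool.complete

namespace KappaBool

variable {κ : Cardinal.{u}}

instance : CoeSort (KappaBool κ) (Type u) :=
  ⟨KappaBool.carrier⟩

/-- The category of `κ`-Boolean algebras and `κ`-join-preserving Boolean homomorphisms. -/
instance : Category.{u} (KappaBool κ) where
  Hom A B := KappaBoolHom κ A B
  id A := KappaBoolHom.id κ A
  comp f g := KappaBoolHom.comp g f

instance : ConcreteCategory (KappaBool κ) (fun A B => KappaBoolHom κ A B) where
  hom f := f
  ofHom f := f

end KappaBool

/-! By the universal property it suffices to find one `κ`-Boolean algebra under `B` and `C`,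
agreeing on `A`, in which `b` and `cᶜ` have nonzero meet unless some `a` separates them. Force with
the non-separated pairs `(x, y)` and take the regular lower sets of this poset. Joins of size `< κ`
are preserved because fewer than `κ` separators can be joined in `A` (`Separated.of_isLUB`), and a
non-separated `(b, cᶜ)` would itself be a condition below both images. -/

open Heyting in
/-- Comparison of regularizations of lower sets is density. -/
theorem LowerSet.toRegular_le_toRegular {P : Type*} [Preorder P] {U V : LowerSet P}
    (h : ∀ p ∈ U, ∃ q ≤ p, q ∈ V) : Regular.toRegular U ≤ Regular.toRegular V := by
  rw [← Regular.coe_le_coe, Regular.coe_toRegular, Regular.coe_toRegular]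
  refine _root_.compl_le_compl (le_compl_iff_disjoint_right.2 (disjoint_iff_inf_le.2 ?_))
  rintro p ⟨hpV, hpU⟩
  obtain ⟨q, hqp, hqV⟩ := h p hpU
  have hq : q ∈ Vᶜ ⊓ V := ⟨Vᶜ.lower hqp hpV, hqV⟩
  rw [compl_inf_self] at hq
  exact hq

theorem Heyting.Regular.isLUB_toRegular_sSup {α : Type*} [Order.Frame α] (s : Set (Regular α)) :
    IsLUB s (toRegular (sSup ((↑) '' s))) := by
  refine ⟨fun x hx => ?_, fun y hy => ?_⟩
  · rw [← Regular.coe_le_coe, Regular.coe_toRegular]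
    exact (le_sSup (Set.mem_image_of_mem _ hx)).trans le_compl_compl
  · refine (Regular.gi.gc _ _).2 (sSup_le ?_)
    rintro _ ⟨x, hx, rfl⟩
    exact hy hx

instance Heyting.Regular.isKappaComplete (κ : Cardinal.{u}) (α : Type u) [Order.Frame α] :
    IsKappaComplete κ (Heyting.Regular α) :=
  ⟨fun s _ => ⟨_, isLUB_toRegular_sSup s⟩⟩

/-- A regular upper bound contains every `L y` with `y ∈ s`; their union is dense below `L x`, and
regular lower sets absorb dense refinement. -/
theorem IsLUB.map_of_monotone_of_dense {P B : Type*} [Preorder P] [Preorder B]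
    {L : B → LowerSet P} (hL : Monotone L) {s : Set B} {x : B} (hx : IsLUB s x)
    (hd : ∀ p ∈ L x, ∃ q ≤ p, ∃ y ∈ s, q ∈ L y) :
    IsLUB ((fun y => Heyting.Regular.toRegular (L y)) '' s) (Heyting.Regular.toRegular (L x)) := by
  refine ⟨?_, fun r hr => ?_⟩
  · rintro _ ⟨y, hy, rfl⟩
    exact Heyting.Regular.toRegular.monotone (hL (hx.1 hy))
  · rw [← Heyting.Regular.toRegular_coe r]
    refine LowerSet.toRegular_le_toRegular fun p hp => ?_
    obtain ⟨q, hqp, y, hy, hq⟩ := hd p hp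
    exact ⟨q, hqp, (Heyting.Regular.gi.gc _ _).1 (hr ⟨y, hy, rfl⟩) hq⟩

/-- A meet-preserving map into lower sets that sends `κ`-joins to dense unions induces a
homomorphism into the regular lower sets. -/
def KappaBoolHom.toRegularLowerSet {κ : Cardinal.{u}} (hκ : Cardinal.aleph0 ≤ κ)
    {P B : Type u} [Preorder P] [BooleanAlgebra B] (L : InfTopHom B (LowerSet P))
    (hd : ∀ s : Set B, Cardinal.mk s < κ → ∀ x, IsLUB s x →
      ∀ p ∈ L x, ∃ q ≤ p, ∃ y ∈ s, q ∈ L y) :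
    KappaBoolHom κ B (Heyting.Regular (LowerSet P)) where
  toFun x := Heyting.Regular.toRegular (L x)
  map_sup' x y := by
    -- Finite joins are `κ`-joins since `ℵ₀ ≤ κ`.
    have h := IsLUB.map_of_monotone_of_dense (OrderHomClass.mono L) (isLUB_pair (a := x) (b := y))
      (hd _ ((Cardinal.lt_aleph0_of_finite _).trans_le hκ) _ isLUB_pair)
    rw [Set.image_pair] at h
    exact h.unique isLUB_pair
  map_inf' x y := by
    apply Heyting.Regular.coe_injective
    change (Heyting.Regular.toRegular (L (x ⊓ y)) : LowerSet P) =
      (Heyting.Regular.toRegular (L x) : LowerSet P) ⊓ (Heyting.Regular.toRegular (L y) : LowerSet P)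
    simp [compl_compl_inf_distrib]
  map_top' := by
    apply Heyting.Regular.coe_injective
    simp
  map_bot' := by
    have h := IsLUB.map_of_monotone_of_dense (OrderHomClass.mono L) (isLUB_empty (α := B))
      (hd _ ((Cardinal.lt_aleph0_of_finite _).trans_le hκ) _ isLUB_empty)
    rw [Set.image_empty] at h
    exact h.unique isLUB_empty
  map_isLUB' s hs _ hx :=
    IsLUB.map_of_monotone_of_dense (OrderHomClass.mono L) hx (hd s hs _ hx)

namespace KappaBoolHom

variable {κ : Cardinal.{u}} {A B C : Type u}
  [BooleanAlgebra A] [BooleanAlgebra B] [BooleanAlgebra C]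

/-- Elements `x` and `y` are separated if some `a` has `x ≤ f a` and `g a` disjoint from `y`. -/
def Separated (f : KappaBoolHom κ A B) (g : KappaBoolHom κ A C) (x : B) (y : C) : Prop :=
  ∃ a, x ≤ f a ∧ y ≤ (g a)ᶜ

variable {f : KappaBoolHom κ A B} {g : KappaBoolHom κ A C} {x : B} {y : C}

theorem Separated.symm (h : Separated f g x y) : Separated g f y x := by
  obtain ⟨a, hx, hy⟩ := h
  exact ⟨aᶜ, by rwa [map_compl'], by rwa [map_compl', compl_compl]⟩

theorem Separated.of_inf_map {a : A} (hx : x ≤ f a) (h : Separated f g x (y ⊓ g a)) :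
    Separated f g x y := by
  obtain ⟨a', hx', hy⟩ := h
  refine ⟨a ⊓ a', by simp [hx, hx'], ?_⟩
  rw [map_inf, le_compl_iff_disjoint_right, disjoint_iff, ← inf_assoc]
  exact (le_compl_iff_disjoint_right.1 hy).eq_bot

/-- The join in `A` of the chosen separators works: `f` need only be monotone, while `g` must
preserve this join. -/
theorem Separated.of_isLUB [IsKappaComplete κ A] {s : Set B} (hs : Cardinal.mk s < κ)
    {z : B} (hz : IsLUB s z) (hx : x ≤ z) (h : ∀ w ∈ s, Separated f g (x ⊓ w) y) :
    Separated f g x y := by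
  choose a ha hya using fun w : s => h w w.2
  have hc : Cardinal.mk (Set.range a) < κ := Cardinal.mk_range_le.trans_lt hs
  obtain ⟨m, hm⟩ := IsKappaComplete.exists_isLUB (Set.range a) hc
  refine ⟨m, ?_, ?_⟩
  -- Heyting implication replaces distributivity of `x ⊓ _` over the join `z`.
  · have : z ≤ x ⇨ f m := hz.2 fun w hw => le_himp_iff'.2 <|
      (ha ⟨w, hw⟩).trans (OrderHomClass.mono f (hm.1 ⟨_, rfl⟩))
    simpa [hx] using le_himp_iff'.1 this
  · rw [le_compl_comm]
    refine (g.map_isLUB hc hm).2 ?_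
    rintro _ ⟨_, ⟨w, rfl⟩, rfl⟩
    exact le_compl_comm.1 (hya w)

/-- The pairs that are not separated, as a forcing poset. -/
abbrev Compatible (f : KappaBoolHom κ A B) (g : KappaBoolHom κ A C) : Type u :=
  {p : B × C // ¬ Separated f g p.1 p.2}

/-- The compatible pairs whose first component is below a given element. -/
def Compatible.fstLE (f : KappaBoolHom κ A B) (g : KappaBoolHom κ A C) :
    InfTopHom B (LowerSet (Compatible f g)) where
  toFun x := ⟨{p | p.1.1 ≤ x}, fun _ _ h hp => h.1.trans hp⟩
  map_inf' x y := by ext p; exact le_inf_iff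
  map_top' := by ext p; exact ⟨fun _ => trivial, fun _ => le_top⟩

/-- The compatible pairs whose second component is below a given element. -/
def Compatible.sndLE (f : KappaBoolHom κ A B) (g : KappaBoolHom κ A C) :
    InfTopHom C (LowerSet (Compatible f g)) where
  toFun y := ⟨{p | p.1.2 ≤ y}, fun _ _ h hp => h.2.trans hp⟩
  map_inf' x y := by ext p; exact le_inf_iff
  map_top' := by ext p; exact ⟨fun _ => trivial, fun _ => le_top⟩

variable [IsKappaComplete κ A]

/-- The left map into the algebra of regular lower sets of compatible pairs. -/
def regularInl (hκ : Cardinal.aleph0 ≤ κ) (f : KappaBoolHom κ A B) (g : KappaBoolHom κ A C) :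
    KappaBoolHom κ B (Heyting.Regular (LowerSet (Compatible f g))) :=
  toRegularLowerSet hκ (Compatible.fstLE f g) fun s hs z hz p hp => by
    by_contra! hq
    refine p.2 (.of_isLUB hs hz hp fun w hw => ?_)
    by_contra hn
    exact hq ⟨(p.1.1 ⊓ w, p.1.2), hn⟩ ⟨inf_le_left, le_rfl⟩ w hw inf_le_right

/-- The right map into the algebra of regular lower sets of compatible pairs. -/
def regularInr (hκ : Cardinal.aleph0 ≤ κ) (f : KappaBoolHom κ A B) (g : KappaBoolHom κ A C) :
    KappaBoolHom κ C (Heyting.Regular (LowerSet (Compatible f g))) :=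
  toRegularLowerSet hκ (Compatible.sndLE f g) fun s hs z hz p hp => by
    by_contra! hq
    refine p.2 (Separated.symm (.of_isLUB hs hz hp fun w hw => ?_))
    by_contra hn
    exact hq ⟨(p.1.1, p.1.2 ⊓ w), fun h => hn h.symm⟩ ⟨le_rfl, inf_le_left⟩ w hw inf_le_right

/-- By `Separated.of_inf_map`, a condition on one side can be refined by `a` on the other, so the
two lower sets are dense in each other. -/
theorem regularInl_map_eq_regularInr_map (hκ : Cardinal.aleph0 ≤ κ) (f : KappaBoolHom κ A B)
    (g : KappaBoolHom κ A C) (a : A) : regularInl hκ f g (f a) = regularInr hκ f g (g a) := by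
  apply le_antisymm
  · refine LowerSet.toRegular_le_toRegular fun p hp => ?_
    exact ⟨⟨(p.1.1, p.1.2 ⊓ g a), fun h => p.2 (h.of_inf_map hp)⟩, ⟨le_rfl, inf_le_left⟩,
      inf_le_right⟩
  · refine LowerSet.toRegular_le_toRegular fun p hp => ?_
    exact ⟨⟨(p.1.1 ⊓ f a, p.1.2), fun h => p.2 (h.symm.of_inf_map hp).symm⟩, ⟨inf_le_left, le_rfl⟩,
      inf_le_right⟩

theorem separated_of_disjoint (hκ : Cardinal.aleph0 ≤ κ)
    (h : Disjoint (regularInl hκ f g x) (regularInr hκ f g y)) : Separated f g x y := by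
  by_contra hn
  let p : Compatible f g := ⟨(x, y), hn⟩
  have hx : p ∈ (regularInl hκ f g x : LowerSet (Compatible f g)) :=
    (le_compl_compl : Compatible.fstLE f g x ≤ _) (le_refl x)
  have hy : p ∈ (regularInr hκ f g y : LowerSet (Compatible f g)) :=
    (le_compl_compl : Compatible.sndLE f g y ≤ _) (le_refl y)
  exact (Heyting.Regular.coe_le_coe.2 h.le_bot) ⟨hx, hy⟩

end KappaBoolHom

theorem mainTheorem5 (κ : Cardinal.{u}) (hκ : κ.IsRegular) {A B C D : KappaBool κ}
    (f : A ⟶ B) (g : A ⟶ C) (g' : B ⟶ D) (f' : C ⟶ D) (h : IsPushout f g g' f')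
    (b : B) (c : C) (hbc : g' b ≤ f' c) :
    ∃ a : A, b ≤ f a ∧ g a ≤ c := by
  let E : KappaBool κ := ⟨Heyting.Regular (LowerSet (KappaBoolHom.Compatible f g))⟩
  let i : B ⟶ E := KappaBoolHom.regularInl hκ.aleph0_le f g
  let j : C ⟶ E := KappaBoolHom.regularInr hκ.aleph0_le f g
  have hij : f ≫ i = g ≫ j :=
    DFunLike.ext (F := KappaBoolHom κ A E) _ _
      (KappaBoolHom.regularInl_map_eq_regularInr_map hκ.aleph0_le f g)
  let d : KappaBoolHom κ D E := h.desc i j hij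
  have hi (x : B) : d (g' x) = i x :=
    DFunLike.congr_fun (F := KappaBoolHom κ B E) (h.inl_desc i j hij) x
  have hj (y : C) : d (f' y) = j y :=
    DFunLike.congr_fun (F := KappaBoolHom κ C E) (h.inr_desc i j hij) y
  have hle : i b ≤ j c := by
    rw [← hi, ← hj]
    exact OrderHomClass.mono d hbc
  -- Separating `b` from `cᶜ` gives `cᶜ ≤ (g a)ᶜ`, that is, `g a ≤ c`.
  have hdis : Disjoint (i b) (j cᶜ) := by
    rw [map_compl']
    exact disjoint_compl_right.mono_left hle
  obtain ⟨a, hb, hc⟩ := KappaBoolHom.separated_of_disjoint hκ.aleph0_le hdis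
  exact ⟨a, hb, compl_le_compl_iff_le.1 hc⟩
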